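/- For a natural number $n$ let $S_n$ be the set of permutations of $[n]=\{1,\dots,n\}$. A permutation $\pi\in S_n$ contains the generalized pattern 21-34 if there are positions $1\le i<i+1<j<j+1\le n$ with $\pi(i+1)<\pi(i)<\pi(j)<\pi(j+1)$. It contains the generalized pattern 34-21 if there are positions $1\le i<i+1<j<j+1\le n$ with $\pi(j+1)<\pi(j)<\pi(i)<\pi(i+1)$. Let $\alpha_n(\text{21-34})$ be the number of $\pi\in S_n$ that do not contain 21-34, and let $\alpha_n(\{\text{21-34},\text{34-21}\})$ be the number of $\pi\in S_n$ that contain neither 21-34 nor 34-21. Then $$\lim_{n\to\infty}\left(\frac{\alpha_n(\{\text{21-34},\text{34-21}\})}{n!}\right)^{1/n}=\frac{1}{2\log 2}\approx 0.7213\ldots,$$ where the decimal means $0.7213<\frac{1}{2\log 2}<0.7214$. Consequently there is a real sequence $\varepsilon_n\to 0$ such that for every $n$ $$\alpha_n(\text{21-34})\ \ge\ \alpha_n(\{\text{21-34},\text{34-21}\})=\left(\frac{1}{2\log 2}+\varepsilon_n\right)^n n!.$$ -/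

import Mathlib

open Filter Topology
open scoped Nat

/-- A generalized pattern `(a₁, ε₁, a₂, …, εₖ₋₁, aₖ)`, with `k = len + 1` letters.
The word `a₁ … aₖ` is the one-line notation of the permutation `perm` (with positions and
values counted from `0`), and `dash i = true` means that a dash separates the letter at
position `i` from the next one. -/
structure GeneralizedPattern where
  len : ℕ
  perm : Equiv.Perm (Fin (len + 1))
  dash : Fin len → Bool

/-- The permutation `π` of `n` letters admits the generalized pattern `p`: at some positions
`ℓ 0 < ℓ 1 < …` it is order-isomorphic to `p.perm`, and positions that belong to two letters
of `p` not separated by a dash are consecutive. -/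
def GeneralizedPattern.Occurs (p : GeneralizedPattern) {n : ℕ} (π : Equiv.Perm (Fin n)) : Prop :=
  ∃ ℓ : Fin (p.len + 1) → Fin n, StrictMono ℓ ∧
    (∀ i j, π (ℓ i) < π (ℓ j) ↔ p.perm i < p.perm j) ∧
    ∀ i : Fin p.len, p.dash i = false → (ℓ i.succ : ℕ) = (ℓ i.castSucc : ℕ) + 1

/-- The number of permutations of `n` letters that avoid every generalized pattern in `P`. -/
noncomputable def avoidCount (n : ℕ) (P : Set GeneralizedPattern) : ℕ :=
  Nat.card {π : Equiv.Perm (Fin n) // ∀ p ∈ P, ¬ p.Occurs π}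

/-- The generalized pattern 21-34. -/
def pattern21d34 : GeneralizedPattern where
  len := 3
  perm := ⟨![1, 0, 2, 3], ![1, 0, 2, 3], by decide, by decide⟩
  dash := ![false, true, false]

/-- The generalized pattern 34-21. -/
def pattern34d21 : GeneralizedPattern where
  len := 3
  perm := ⟨![2, 3, 1, 0], ![3, 2, 0, 1], by decide, by decide⟩
  dash := ![false, true, false]

/-!
Avoiding both patterns means that no ascent bottom exceeds a descent top, wherever the ascent and the
descent stand. Equivalently (`avoids_iff_exists_isThreshold`) there is a threshold `k` such that
every value below `k` (small) is followed by a larger entry and every other value (large) by a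
smaller one. So the word splits into alternating blocks of small values, which increase, and of large
values, which decrease. Up to the choice of `k` and of the type of the first block, such a word is a
pair of ordered set partitions, of the `k` small and of the `m = n - k` large values, whose numbers
of blocks differ by at most one. An ordered set partition into `p` blocks is a surjection onto `p`
elements, and the surjections have the exponential generating function `(e ^ X - 1) ^ p`
(`surjCount_eq_coeff`).

For the upper bound, the nonnegative coefficients give
`surjCount k p * x ^ k ≤ k ! * (e ^ x - 1) ^ p` and the same with `m`, `q`, `y`. With
`x = 2 * log 2 * k / n` and `y = 2 * log 2 * m / n` the number `(e ^ x - 1) * (e ^ y - 1)` is at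
most `1`, and so all the summands are at most `n ! / (2 * log 2) ^ n` up to a polynomial factor
(`surjCount_mul_surjCount_mul_pow_le`).

For the lower bound, take `k` to be half of `n` and the same number of blocks on both sides. The
number of all ordered set partitions of `m` elements is at least `m ! / (2 * (log 2) ^ m)`
(`half_mul_inv_log_two_pow_le`), so some number of blocks has at least a fraction `1 / (m + 1)` of
that, and `(2 * m)! ≤ 4 ^ m * (m !) ^ 2` turns its square into `n ! / (2 * log 2) ^ n`, again up to
a polynomial factor (`factorial_le_avoidCount_mul_pow`).
-/

/-! ### Thresholds -/

theorem strictMono_of_lt_next {α : Type*} [Preorder α] {n : ℕ} {f : Fin n → α}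
    (h : ∀ i j : Fin n, (j : ℕ) = i + 1 → f i < f j) : StrictMono f := by
  cases n with
  | zero => exact fun i => i.elim0
  | succ n => exact Fin.strictMono_iff_lt_succ.2 fun i => h _ _ (by simp)

theorem pattern21d34_occurs_iff {n : ℕ} {π : Equiv.Perm (Fin n)} :
    pattern21d34.Occurs π ↔ ∃ a b c d : Fin n, (b : ℕ) = a + 1 ∧ b < c ∧ (d : ℕ) = c + 1 ∧
      π b < π a ∧ π a < π c ∧ π c < π d := by
  constructor
  · rintro ⟨ℓ, hm, hp, hd⟩
    change Fin 4 → Fin n at ℓ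
    refine ⟨ℓ 0, ℓ 1, ℓ 2, ℓ 3, hd (0 : Fin 3) rfl, hm (by decide : (1 : Fin 4) < 2),
      hd (2 : Fin 3) rfl, (hp (1 : Fin 4) (0 : Fin 4)).2 (by decide),
      (hp (0 : Fin 4) (2 : Fin 4)).2 (by decide), (hp (2 : Fin 4) (3 : Fin 4)).2 (by decide)⟩
  · rintro ⟨a, b, c, d, hab, hbc, hcd, h1, h2, h3⟩
    refine ⟨(![a, b, c, d] : Fin 4 → Fin n), ?_, ?_, ?_⟩
    · refine Fin.strictMono_iff_lt_succ.2 fun (i : Fin 3) => ?_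
      fin_cases i
      · exact Fin.lt_def.2 (by simp [hab])
      · exact hbc
      · exact Fin.lt_def.2 (by simp [hcd])
    · change ∀ i j : Fin 4, π ((![a, b, c, d] : Fin 4 → Fin n) i) < π (![a, b, c, d] j) ↔
        (![1, 0, 2, 3] : Fin 4 → Fin 4) i < ![1, 0, 2, 3] j
      simp only [Fin.forall_fin_succ, IsEmpty.forall_iff, and_true, Matrix.cons_val_zero,
        Matrix.cons_val_succ]
      refine ⟨⟨?_, ?_, ?_, ?_⟩, ⟨?_, ?_, ?_, ?_⟩, ⟨?_, ?_, ?_, ?_⟩, ?_, ?_, ?_, ?_⟩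
      all_goals
        first
        | exact iff_of_true (by order) (by decide)
        | exact iff_of_false (fun _ => by order) (by decide)
    · change ∀ i : Fin 3, _
      intro i
      fin_cases i
      · exact fun _ => hab
      · exact fun h => by simp [pattern21d34] at h
      · exact fun _ => hcd

theorem pattern34d21_occurs_iff {n : ℕ} {π : Equiv.Perm (Fin n)} :
    pattern34d21.Occurs π ↔ ∃ a b c d : Fin n, (b : ℕ) = a + 1 ∧ b < c ∧ (d : ℕ) = c + 1 ∧
      π d < π c ∧ π c < π a ∧ π a < π b := by
  constructor
  · rintro ⟨ℓ, hm, hp, hd⟩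
    change Fin 4 → Fin n at ℓ
    refine ⟨ℓ 0, ℓ 1, ℓ 2, ℓ 3, hd (0 : Fin 3) rfl, hm (by decide : (1 : Fin 4) < 2),
      hd (2 : Fin 3) rfl, (hp (3 : Fin 4) (2 : Fin 4)).2 (by decide),
      (hp (2 : Fin 4) (0 : Fin 4)).2 (by decide), (hp (0 : Fin 4) (1 : Fin 4)).2 (by decide)⟩
  · rintro ⟨a, b, c, d, hab, hbc, hcd, h1, h2, h3⟩
    refine ⟨(![a, b, c, d] : Fin 4 → Fin n), ?_, ?_, ?_⟩
    · refine Fin.strictMono_iff_lt_succ.2 fun (i : Fin 3) => ?_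
      fin_cases i
      · exact Fin.lt_def.2 (by simp [hab])
      · exact hbc
      · exact Fin.lt_def.2 (by simp [hcd])
    · change ∀ i j : Fin 4, π ((![a, b, c, d] : Fin 4 → Fin n) i) < π (![a, b, c, d] j) ↔
        (![2, 3, 1, 0] : Fin 4 → Fin 4) i < ![2, 3, 1, 0] j
      simp only [Fin.forall_fin_succ, IsEmpty.forall_iff, and_true, Matrix.cons_val_zero,
        Matrix.cons_val_succ]
      refine ⟨⟨?_, ?_, ?_, ?_⟩, ⟨?_, ?_, ?_, ?_⟩, ⟨?_, ?_, ?_, ?_⟩, ?_, ?_, ?_, ?_⟩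
      all_goals
        first
        | exact iff_of_true (by order) (by decide)
        | exact iff_of_false (fun _ => by order) (by decide)
    · change ∀ i : Fin 3, _
      intro i
      fin_cases i
      · exact fun _ => hab
      · exact fun h => by simp [pattern34d21] at h
      · exact fun _ => hcd

/-- `k` is a threshold of `π` if every entry of the word `π` below `k` is followed by a larger
entry and every entry that is at least `k` is followed by a smaller one. -/
def IsThreshold {n : ℕ} (π : Equiv.Perm (Fin n)) (k : ℕ) : Prop :=
  ∀ i j : Fin n, (j : ℕ) = i + 1 → ((π i : ℕ) < k → π i < π j) ∧ (k ≤ (π i : ℕ) → π j < π i)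

/-- Avoiding both patterns says that no ascent bottom exceeds a descent top, whatever the order in
which the ascent and the descent appear. Overlapping pairs satisfy this for free. -/
theorem avoids_iff_exists_isThreshold {n : ℕ} {π : Equiv.Perm (Fin n)} :
    (∀ p ∈ ({pattern21d34, pattern34d21} : Set GeneralizedPattern), ¬ p.Occurs π) ↔
      ∃ k ≤ n, IsThreshold π k := by
  simp only [Set.mem_insert_iff, Set.mem_singleton_iff, forall_eq_or_imp, forall_eq,
    pattern21d34_occurs_iff, pattern34d21_occurs_iff]
  constructor
  · rintro ⟨h1, h2⟩
    have hex : ∃ k, k = n ∨ ∃ a b : Fin n, (b : ℕ) = a + 1 ∧ π b < π a ∧ (π a : ℕ) = k :=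
      ⟨n, Or.inl rfl⟩
    classical
    -- The threshold is the smallest descent top, or `n` if there is no descent.
    refine ⟨Nat.find hex, Nat.find_min' hex (Or.inl rfl), fun i j hij => ⟨fun hi => ?_, fun hi => ?_⟩⟩
    · have hne : π j ≠ π i := fun h => by have := π.injective h; omega
      refine lt_of_le_of_ne (not_lt.1 fun h => ?_) hne.symm
      exact absurd (Nat.find_min' hex (Or.inr ⟨i, j, hij, h, rfl⟩)) (by omega)
    · refine lt_of_le_of_ne (not_lt.1 fun h => ?_) fun h => by have := π.injective h; omega
      rcases Nat.find_spec hex with hk | ⟨a, b, hab, hba, hk⟩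
      · have := (π i).2
        omega
      · rw [← hk] at hi
        have hai : a ≠ i := by
          rintro rfl
          have : j = b := Fin.ext (by omega)
          subst this
          exact lt_asymm h hba
        have hlt : π a < π i := lt_of_le_of_ne hi fun e => hai (π.injective e)
        rcases lt_trichotomy (b : ℕ) i with hbi | hbi | hbi
        · exact h1 ⟨a, b, i, j, hab, hbi, hij, hba, hlt, h⟩
        · have : b = i := Fin.ext hbi
          subst this
          exact lt_asymm hlt hba
        · rcases lt_trichotomy (j : ℕ) a with hja | hja | hja
          · exact h2 ⟨i, j, a, b, hij, hja, hab, hba, hlt, h⟩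
          · have : j = a := Fin.ext hja
            subst this
            exact lt_asymm hlt h
          · exact hai (Fin.ext (by omega))
  · rintro ⟨k, -, hk⟩
    refine ⟨?_, ?_⟩
    · rintro ⟨a, b, c, d, hab, -, hcd, hba, hac, hcd'⟩
      have ha : ¬ (π a : ℕ) < k := fun h => lt_asymm ((hk a b hab).1 h) hba
      have hc : ¬ k ≤ (π c : ℕ) := fun h => lt_asymm ((hk c d hcd).2 h) hcd'
      have := Fin.lt_def.1 hac
      omega
    · rintro ⟨a, b, c, d, hab, -, hcd, hdc, hca, hab'⟩
      have hc : ¬ (π c : ℕ) < k := fun h => lt_asymm ((hk c d hcd).1 h) hdc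
      have ha : ¬ k ≤ (π a : ℕ) := fun h => lt_asymm ((hk a b hab).2 h) hab'
      have := Fin.lt_def.1 hca
      omega

/-! ### Sorting by blocks -/

/-- The sorting key of the value `v` when the blocks are numbered by `b`: first by block, and inside
a block increasingly for values below `k` and decreasingly for the others. -/
def blockKey {n : ℕ} (k : ℕ) (b : Fin n → ℕ) (v : Fin n) : ℕ ×ₗ ℤ :=
  toLex (b v, if (v : ℕ) < k then (v : ℤ) else -(v : ℤ))

theorem blockKey_lt_iff {n k : ℕ} {b : Fin n → ℕ} {v w : Fin n} :
    blockKey k b v < blockKey k b w ↔ b v < b w ∨ b v = b w ∧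
      (if (v : ℕ) < k then (v : ℤ) else -(v : ℤ)) < if (w : ℕ) < k then (w : ℤ) else -(w : ℤ) := by
  simp [blockKey, Prod.Lex.toLex_lt_toLex]

theorem blockKey_injective {n : ℕ} (k : ℕ) (b : Fin n → ℕ) :
    Function.Injective (blockKey k b) := by
  intro v w h
  have h2 := congrArg (fun x => (ofLex x).2) h
  simp only [blockKey, ofLex_toLex] at h2
  apply Fin.ext
  split_ifs at h2 <;> omega

theorem strictMono_blockKey_sort {n : ℕ} (k : ℕ) (b : Fin n → ℕ) :
    StrictMono (blockKey k b ∘ Tuple.sort (blockKey k b)) :=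
  (Tuple.monotone_sort _).strictMono_of_injective
    ((blockKey_injective k b).comp (Equiv.injective _))

theorem eq_sort_of_strictMono_blockKey {n k : ℕ} {b : Fin n → ℕ} {π : Equiv.Perm (Fin n)}
    (h : StrictMono (blockKey k b ∘ π)) : π = Tuple.sort (blockKey k b) := by
  have := Tuple.unique_monotone h.monotone (Tuple.monotone_sort (blockKey k b))
  ext i
  exact congrArg Fin.val (blockKey_injective k b (congrFun this i))

/-- If the entries are sorted by blocks and the block numbers in use have no gaps, then neighbouring
entries lie in the same block or in consecutive ones. -/
theorem block_next_le {n k : ℕ} {b : Fin n → ℕ} {π : Equiv.Perm (Fin n)}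
    (h : StrictMono (blockKey k b ∘ π))
    (hb : ∀ v w c, b v < c → c < b w → ∃ u, b u = c) {i j : Fin n} (hij : (j : ℕ) = i + 1) :
    b (π i) ≤ b (π j) ∧ b (π j) ≤ b (π i) + 1 := by
  have hmono : ∀ x y : Fin n, x < y → b (π x) ≤ b (π y) := fun x y hxy => by
    rcases blockKey_lt_iff.1 (h hxy) with h' | h'
    exacts [h'.le, h'.1.le]
  refine ⟨hmono i j (Fin.lt_def.2 (by omega)), not_lt.1 fun hlt => ?_⟩
  obtain ⟨u, hu⟩ := hb _ _ _ (Nat.lt_succ_self (b (π i))) hlt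
  have hx := hu
  rw [← π.apply_symm_apply u] at hx
  rcases le_or_gt (π.symm u) i with hle | hgt
  · rcases hle.eq_or_lt with he | hl
    · rw [he] at hx; omega
    · have := hmono _ _ hl; omega
  · have : j ≤ π.symm u := Fin.le_def.2 (by have := Fin.lt_def.1 hgt; omega)
    rcases this.eq_or_lt with he | hl
    · rw [← he] at hx; omega
    · have := hmono _ _ hl; omega

/-- With small values in even blocks and large values in odd ones, two neighbouring small entries
cannot lie in different blocks, so they are in increasing order; similarly for large entries. -/
theorem isThreshold_of_strictMono_blockKey {n k : ℕ} {b : Fin n → ℕ} {π : Equiv.Perm (Fin n)}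
    (h : StrictMono (blockKey k b ∘ π))
    (hpar : ∀ v : Fin n, b v % 2 = if (v : ℕ) < k then 0 else 1)
    (hb : ∀ v w c, b v < c → c < b w → ∃ u, b u = c) : IsThreshold π k := by
  intro i j hij
  have hlt := blockKey_lt_iff.1 (h (Fin.lt_def.2 (by omega) : i < j))
  have hnext := block_next_le h hb hij
  have h1 := hpar (π i)
  have h2 := hpar (π j)
  simp only [Fin.lt_def]
  split_ifs at * <;> constructor <;> intro hk <;> omega

/-- The blocks can be read off from the sorted permutation: the first one has number `0`, and the
number grows by one exactly where the entries change between small and large. -/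
theorem block_unique {n k : ℕ} {b b' : Fin n → ℕ} {π : Equiv.Perm (Fin n)}
    (h : StrictMono (blockKey k b ∘ π)) (h' : StrictMono (blockKey k b' ∘ π))
    (hpar : ∀ v : Fin n, b v % 2 = if (v : ℕ) < k then 0 else 1)
    (hpar' : ∀ v : Fin n, b' v % 2 = if (v : ℕ) < k then 0 else 1)
    (hb : ∀ w c, c < b w → ∃ u, b u = c) (hb' : ∀ w c, c < b' w → ∃ u, b' u = c) : b = b' := by
  have hzero : ∀ {b : Fin n → ℕ}, StrictMono (blockKey k b ∘ π) →
      (∀ w c, c < b w → ∃ u, b u = c) → ∀ i : Fin n, (i : ℕ) = 0 → b (π i) = 0 := by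
    intro b h hb i hi
    by_contra hne
    obtain ⟨u, hu⟩ := hb _ 0 (Nat.pos_of_ne_zero hne)
    rw [← π.apply_symm_apply u] at hu
    have hle : i ≤ π.symm u := Fin.le_def.2 (by omega)
    rcases hle.eq_or_lt with he | hl
    · rw [← he] at hu; omega
    · have := blockKey_lt_iff.1 (h hl); omega
  have key : ∀ m (hm : m < n), b (π ⟨m, hm⟩) = b' (π ⟨m, hm⟩) := by
    intro m
    induction m with
    | zero => exact fun hm => by rw [hzero h hb _ rfl, hzero h' hb' _ rfl]
    | succ m ih =>
      intro hm
      have hs := ih (by omega)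
      have n1 := block_next_le (i := ⟨m, by omega⟩) (j := ⟨m + 1, hm⟩) h
        (fun _ w c _ hc => hb w c hc) rfl
      have n2 := block_next_le (i := ⟨m, by omega⟩) (j := ⟨m + 1, hm⟩) h'
        (fun _ w c _ hc => hb' w c hc) rfl
      have p1 := hpar (π ⟨m + 1, hm⟩)
      have p2 := hpar' (π ⟨m + 1, hm⟩)
      omega
  funext v
  have := key (π.symm v) (π.symm v).2
  simpa using this

/-- A running count of the changes in the truth value of `t`, with the parity that encodes `t`. -/
theorem exists_block_count (t : ℕ → Prop) : ∃ c : ℕ → ℕ, c 0 ≤ 1 ∧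
    (∀ i, c i ≤ c (i + 1) ∧ c (i + 1) ≤ c i + 1) ∧ ∀ i, c i % 2 = 1 ↔ t i := by
  classical
  let c : ℕ → ℕ := fun i => Nat.rec (if t 0 then 1 else 0)
    (fun i x => if (x % 2 = 1 ↔ t (i + 1)) then x else x + 1) i
  have hs : ∀ i, c (i + 1) = if (c i % 2 = 1 ↔ t (i + 1)) then c i else c i + 1 := fun i => rfl
  have h0 : c 0 = if t 0 then 1 else 0 := rfl
  refine ⟨c, ?_, fun i => ?_, fun i => ?_⟩
  · rw [h0]; split_ifs <;> omega
  · rw [hs]; split_ifs <;> omega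
  · cases i with
    | zero => rw [h0]; split_ifs <;> simp [*]
    | succ i =>
      rw [hs]
      split_ifs with h
      · exact h
      · by_cases ht : t (i + 1) <;> simp only [ht, iff_true, iff_false] at h ⊢ <;> omega

theorem exists_eq_of_step_le_one {c : ℕ → ℕ} (hc : ∀ i, c i ≤ c (i + 1) ∧ c (i + 1) ≤ c i + 1)
    {N x : ℕ} (h0 : c 0 ≤ x) (hx : x ≤ c N) : ∃ i ≤ N, c i = x := by
  induction N with
  | zero => exact ⟨0, le_rfl, by omega⟩
  | succ N ih =>
    rcases Nat.lt_or_ge (c N) x with h | h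
    · exact ⟨N + 1, le_rfl, by have := hc N; omega⟩
    · obtain ⟨i, hi, h⟩ := ih h
      exact ⟨i, by omega, h⟩

/-! ### Counting avoiding permutations by pairs of surjections -/

/-- The number of surjections from a set of `k` elements onto a set of `p` elements. -/
noncomputable def surjCount (k p : ℕ) : ℕ :=
  Nat.card {f : Fin k → Fin p // Function.Surjective f}

/-- The numbering of the blocks given by `f` (blocks of the `k` small values) and `g` (blocks of the
`m` large values): small blocks get the even numbers from `s` on, large blocks the odd ones. So
`s = 0` puts a small block first, and `s = 2` a large one. -/
def blockNumber {k m p q : ℕ} (s : ℕ) (f : Fin k → Fin p) (g : Fin m → Fin q) :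
    Fin (k + m) → ℕ :=
  Fin.append (fun i => 2 * (f i : ℕ) + s) (fun j => 2 * (g j : ℕ) + 1)

section
variable {k m p q s : ℕ} {f : Fin k → Fin p} {g : Fin m → Fin q}

@[simp] theorem blockNumber_castAdd (i : Fin k) :
    blockNumber s f g (Fin.castAdd m i) = 2 * (f i : ℕ) + s := Fin.append_left _ _ i

@[simp] theorem blockNumber_natAdd (j : Fin m) :
    blockNumber s f g (Fin.natAdd k j) = 2 * (g j : ℕ) + 1 := Fin.append_right _ _ j

theorem blockNumber_mod_two (v : Fin (k + m)) :
    blockNumber 0 f g v % 2 = if (v : ℕ) < k then 0 else 1 := by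
  induction v using Fin.addCases with
  | left i => simp
  | right j => simp [Nat.add_mod]

end

theorem exists_blockNumber_eq {k m p : ℕ} {f : Fin k → Fin p} {g : Fin m → Fin p}
    (hf : Function.Surjective f) (hg : Function.Surjective g) (w : Fin (k + m)) (c : ℕ)
    (hc : c < blockNumber 0 f g w) : ∃ u, blockNumber 0 f g u = c := by
  have hlt : blockNumber 0 f g w < 2 * p := by
    induction w using Fin.addCases with
    | left i => simp
    | right j => have := (g j).2; simp; omega
  rcases Nat.even_or_odd' c with ⟨d, rfl | rfl⟩
  · obtain ⟨i, hi⟩ := hf ⟨d, by omega⟩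
    exact ⟨Fin.castAdd m i, by simp [hi]⟩
  · obtain ⟨j, hj⟩ := hg ⟨d, by omega⟩
    exact ⟨Fin.natAdd k j, by simp [hj]⟩

/-- Equally many blocks of small and of large values can be interleaved to a permutation that avoids
both patterns, and the blocks can be read off from the permutation. -/
theorem surjCount_mul_surjCount_le (k m p : ℕ) :
    surjCount k p * surjCount m p ≤ avoidCount (k + m) {pattern21d34, pattern34d21} := by
  rw [surjCount, surjCount, ← Nat.card_prod, avoidCount]
  refine Nat.card_le_card_of_injective (fun x => ⟨Tuple.sort (blockKey k (blockNumber 0 x.1.1 x.2.1)),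
    avoids_iff_exists_isThreshold.2 ⟨k, by omega,
      isThreshold_of_strictMono_blockKey (strictMono_blockKey_sort _ _) blockNumber_mod_two
        fun _ w c _ hc => exists_blockNumber_eq x.1.2 x.2.2 w c hc⟩⟩) ?_
  rintro ⟨⟨f, hf⟩, ⟨g, hg⟩⟩ ⟨⟨f', hf'⟩, ⟨g', hg'⟩⟩ h
  have h := congrArg Subtype.val h
  dsimp only at h
  have h1 := strictMono_blockKey_sort k (blockNumber 0 f g)
  have h2 := strictMono_blockKey_sort k (blockNumber 0 f' g')
  rw [← h] at h2
  have hb := block_unique h1 h2 blockNumber_mod_two blockNumber_mod_two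
    (exists_blockNumber_eq hf hg) (exists_blockNumber_eq hf' hg')
  have hff : f = f' := funext fun i => Fin.ext (by simpa using congrFun hb (Fin.castAdd m i))
  have hgg : g = g' := funext fun j => Fin.ext (by simpa using congrFun hb (Fin.natAdd k j))
  subst hff hgg
  rfl

/-- A permutation with threshold `k` is obtained by interleaving the blocks of two surjections. -/
theorem IsThreshold.exists_blockNumber {k m : ℕ} {π : Equiv.Perm (Fin (k + m))}
    (h : IsThreshold π k) (hpos : 0 < k + m) :
    ∃ s ∈ ({0, 2} : Finset ℕ), ∃ p ≤ k + m, ∃ q ≤ k + m, p ≤ q + 1 ∧ q ≤ p + 1 ∧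
      ∃ (f : Fin k → Fin p) (g : Fin m → Fin q), Function.Surjective f ∧ Function.Surjective g ∧
        StrictMono (blockKey k (blockNumber s f g) ∘ π) := by
  obtain ⟨c, hc0, hc, hct⟩ := exists_block_count fun i => ∃ hi : i < k + m, k ≤ (π ⟨i, hi⟩ : ℕ)
  have hmono : Monotone c := monotone_nat_of_le_succ fun i => (hc i).1
  have hpar : ∀ v : Fin (k + m), c (π.symm v) % 2 = 1 ↔ k ≤ (v : ℕ) := fun v => by
    rw [hct]; simp
  set M := c (k + m - 1) with hM
  have hub : ∀ v : Fin (k + m), c (π.symm v) ≤ M := fun v => hmono (by omega)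
  have hlb : ∀ v : Fin (k + m), c 0 ≤ c (π.symm v) := fun v => hmono (by omega)
  have hMle : M ≤ k + m := by
    have : ∀ i, c i ≤ i + 1 := fun i => by
      induction i with
      | zero => omega
      | succ i ih => have := hc i; omega
    have := this (k + m - 1)
    omega
  have hex : ∀ x, c 0 ≤ x → x ≤ M → ∃ v : Fin (k + m), c (π.symm v) = x := fun x h0 hx => by
    obtain ⟨i, hi, rfl⟩ := exists_eq_of_step_le_one hc h0 hx
    exact ⟨π ⟨i, by omega⟩, by simp⟩
  have hs2 : 2 * c 0 = 0 ∨ 2 * c 0 = 2 := by omega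
  -- A small block has an even number; if the first block is large, the first even number is `2`.
  have hleft : ∀ i : Fin k, c (π.symm (Fin.castAdd m i)) % 2 = 0 := fun i => by
    have := hpar (Fin.castAdd m i)
    simp only [Fin.val_castAdd] at this
    omega
  have hright : ∀ j : Fin m, c (π.symm (Fin.natAdd k j)) % 2 = 1 := fun j => by
    rw [hpar]; simp
  have hf : ∀ i : Fin k, (c (π.symm (Fin.castAdd m i)) - 2 * c 0) / 2 < (M + 2 - 2 * c 0) / 2 :=
    fun i => by
      have := hub (Fin.castAdd m i)
      have := hlb (Fin.castAdd m i)
      have := hleft i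
      omega
  have hg : ∀ j : Fin m, (c (π.symm (Fin.natAdd k j)) - 1) / 2 < (M + 1) / 2 := fun j => by
    have := hub (Fin.natAdd k j)
    have := hright j
    omega
  have hb : blockNumber (2 * c 0) (fun i => (⟨_, hf i⟩ : Fin _)) (fun j => (⟨_, hg j⟩ : Fin _)) =
      fun v => c (π.symm v) := by
    funext v
    induction v using Fin.addCases with
    | left i =>
      have := hlb (Fin.castAdd m i)
      have := hleft i
      simp only [blockNumber_castAdd]
      omega
    | right j =>
      have := hright j
      simp only [blockNumber_natAdd]
      omega
  refine ⟨2 * c 0, by simpa using hs2, (M + 2 - 2 * c 0) / 2, by omega, (M + 1) / 2, by omega,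
    by omega, by omega, fun i => ⟨_, hf i⟩, fun j => ⟨_, hg j⟩, ?_, ?_, ?_⟩
  · rintro ⟨x, hx⟩
    obtain ⟨v, hv⟩ := hex (2 * x + 2 * c 0) (by omega) (by omega)
    have hvk : (v : ℕ) < k := by
      have := hpar v
      omega
    refine ⟨⟨v, hvk⟩, Fin.ext ?_⟩
    have : Fin.castAdd m ⟨v, hvk⟩ = v := rfl
    simp only [this]
    omega
  · rintro ⟨x, hx⟩
    obtain ⟨v, hv⟩ := hex (2 * x + 1) (by omega) (by omega)
    have hvk : k ≤ (v : ℕ) := by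
      have := hpar v
      omega
    refine ⟨⟨v - k, by omega⟩, Fin.ext ?_⟩
    have : Fin.natAdd k (⟨v - k, by omega⟩ : Fin m) = v := Fin.ext (by simp; omega)
    simp only [this]
    omega
  · refine strictMono_of_lt_next fun i j hij => ?_
    rw [Function.comp_apply, Function.comp_apply, blockKey_lt_iff, hb]
    simp only [Equiv.symm_apply_apply]
    have h1 := h i j hij
    have h2 := hc i
    rw [← hij] at h2
    have h3 := hpar (π i)
    have h4 := hpar (π j)
    simp only [Equiv.symm_apply_apply, Fin.lt_def] at h1 h3 h4
    split_ifs <;> omega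

open Classical in
/-- Every avoiding permutation of `n` letters is obtained from a threshold and a pair of surjections
onto almost equally many blocks. -/
theorem avoidCount_le_sum {n : ℕ} (hn : 0 < n) :
    avoidCount n {pattern21d34, pattern34d21} ≤
      ∑ k ∈ Finset.range (n + 1), ∑ _s ∈ ({0, 2} : Finset ℕ),
        ∑ y ∈ (Finset.range (n + 1) ×ˢ Finset.range (n + 1)).filter
          fun y => y.1 ≤ y.2 + 1 ∧ y.2 ≤ y.1 + 1, surjCount k y.1 * surjCount (n - k) y.2 := by
  have hthr : ∀ k m, k + m = n → Nat.card {π : Equiv.Perm (Fin n) // IsThreshold π k} ≤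
      ∑ _s ∈ ({0, 2} : Finset ℕ),
        ∑ y ∈ (Finset.range (n + 1) ×ˢ Finset.range (n + 1)).filter
          fun y => y.1 ≤ y.2 + 1 ∧ y.2 ≤ y.1 + 1, surjCount k y.1 * surjCount m y.2 := by
    rintro k m rfl
    let F : ∀ s : ℕ, ∀ y : ℕ × ℕ, {f : Fin k → Fin y.1 // Function.Surjective f} ×
        {g : Fin m → Fin y.2 // Function.Surjective g} → Equiv.Perm (Fin (k + m)) :=
      fun s y x => Tuple.sort (blockKey k (blockNumber s x.1.1 x.2.1))
    rw [Nat.card_eq_fintype_card, Fintype.card_subtype]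
    have hsub : Finset.univ.filter (fun π : Equiv.Perm (Fin (k + m)) => IsThreshold π k) ⊆
        ({0, 2} : Finset ℕ).biUnion fun s =>
          ((Finset.range (k + m + 1) ×ˢ Finset.range (k + m + 1)).filter
            fun y => y.1 ≤ y.2 + 1 ∧ y.2 ≤ y.1 + 1).biUnion fun y =>
              Finset.univ.image (F s y) := by
      intro π hπ
      obtain ⟨s, hs, p, hp, q, hq, hpq, hqp, f, g, hf, hg, hm⟩ :=
        (Finset.mem_filter.1 hπ).2.exists_blockNumber hn
      refine Finset.mem_biUnion.2 ⟨s, hs, Finset.mem_biUnion.2 ⟨(p, q), ?_, ?_⟩⟩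
      · simp only [Finset.mem_filter, Finset.mem_product, Finset.mem_range]
        omega
      · exact Finset.mem_image.2 ⟨⟨⟨f, hf⟩, ⟨g, hg⟩⟩, Finset.mem_univ _,
          (eq_sort_of_strictMono_blockKey hm).symm⟩
    refine (Finset.card_le_card hsub).trans <| Finset.card_biUnion_le.trans <|
      Finset.sum_le_sum fun s _ => Finset.card_biUnion_le.trans <|
      Finset.sum_le_sum fun y _ => Finset.card_image_le.trans ?_
    rw [Finset.card_univ, ← Nat.card_eq_fintype_card, Nat.card_prod]
    rfl
  refine le_trans ?_ (Finset.sum_le_sum fun k hk => hthr k (n - k)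
    (Nat.add_sub_cancel' (Finset.mem_range_succ_iff.1 hk)))
  simp only [avoidCount, avoids_iff_exists_isThreshold, Nat.card_eq_fintype_card,
    Fintype.card_subtype]
  refine (Finset.card_le_card ?_).trans Finset.card_biUnion_le
  intro π hπ
  obtain ⟨k, hk, h⟩ := (Finset.mem_filter.1 hπ).2
  exact Finset.mem_biUnion.2 ⟨k, Finset.mem_range_succ_iff.2 hk, by simpa using h⟩

/-! ### Growth of the number of surjections -/

theorem surjCount_eq_card_image_eq {k p : ℕ} (S : Finset (Fin p)) :
    (Finset.univ.filter fun f : Fin k → Fin p => Finset.univ.image f = S).card =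
      surjCount k S.card := by
  rw [← Fintype.card_subtype, ← Nat.card_eq_fintype_card, surjCount]
  let e : Fin S.card ≃ S := S.equivFin.symm
  refine Nat.card_congr
    { toFun := fun f => ⟨fun i => e.symm ⟨f.1 i, f.2.le (Finset.mem_image_of_mem _ (Finset.mem_univ i))⟩, ?_⟩
      invFun := fun g => ⟨fun i => (e (g.1 i) : Fin p), ?_⟩
      left_inv := fun f => by ext i; simp
      right_inv := fun g => by ext i; simp }
  · intro x
    have hx : (e x : Fin p) ∈ Finset.univ.image f.1 := by rw [f.2]; exact (e x).2
    obtain ⟨i, -, hi⟩ := Finset.mem_image.1 hx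
    refine ⟨i, ?_⟩
    rw [Equiv.symm_apply_eq]
    exact Subtype.ext hi
  · ext y
    constructor
    · intro hy
      obtain ⟨i, -, rfl⟩ := Finset.mem_image.1 hy
      exact (e (g.1 i)).2
    · intro hy
      obtain ⟨i, hi⟩ := g.2 (e.symm ⟨y, hy⟩)
      exact Finset.mem_image.2 ⟨i, Finset.mem_univ _, by simp [hi]⟩

/-- All functions into a set of `p` elements, classified by their image. -/
theorem sum_choose_mul_surjCount (k p : ℕ) :
    ∑ j ∈ Finset.range (p + 1), p.choose j * surjCount k j = p ^ k := by
  classical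
  have h := Finset.card_eq_sum_card_fiberwise (s := (Finset.univ : Finset (Fin k → Fin p)))
    (t := (Finset.univ : Finset (Fin p)).powerset) (f := fun f => Finset.univ.image f)
    (fun f _ => by simp)
  simp only [surjCount_eq_card_image_eq, Finset.card_univ, Fintype.card_fun, Fintype.card_fin] at h
  rw [h, Finset.sum_powerset_apply_card (fun j => surjCount k j)]
  simp

open PowerSeries in
/-- The exponential generating function of the surjections onto `p` elements is `(e ^ X - 1) ^ p`. -/
theorem surjCount_eq_coeff (k p : ℕ) :
    (surjCount k p : ℝ) = k ! * coeff k ((exp ℝ - 1) ^ p) := by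
  induction p using Nat.strong_induction_on with
  | _ p ih =>
    have h1 : (∑ j ∈ Finset.range (p + 1), (p.choose j : ℝ) * surjCount k j) = p ^ k := by
      exact_mod_cast sum_choose_mul_surjCount k p
    have h2 : (∑ j ∈ Finset.range (p + 1),
        (p.choose j : ℝ) * (k ! * coeff k ((exp ℝ - 1) ^ j))) = p ^ k := by
      have : exp ℝ ^ p = ∑ j ∈ Finset.range (p + 1), (exp ℝ - 1) ^ j * C (p.choose j : ℝ) := by
        conv_lhs => rw [← sub_add_cancel (exp ℝ) 1, add_pow]
        simp
      have hc := congrArg (coeff k) this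
      rw [exp_pow_eq_rescale_exp, coeff_rescale, coeff_exp, map_sum] at hc
      have hk : (k ! : ℝ) ≠ 0 := by positivity
      calc _ = (k ! : ℝ) * ∑ j ∈ Finset.range (p + 1),
            coeff k ((exp ℝ - 1) ^ j * C (p.choose j : ℝ)) := by
            rw [Finset.mul_sum]
            refine Finset.sum_congr rfl fun j _ => ?_
            rw [coeff_mul_C]
            ring
        _ = p ^ k := by
            rw [← hc]
            simp only [one_div, map_inv₀, map_natCast]
            field_simp
    rw [Finset.sum_range_succ] at h1 h2
    rw [Finset.sum_congr rfl fun j hj => by rw [ih j (Finset.mem_range.1 hj)]] at h1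
    simp only [Nat.choose_self, Nat.cast_one, one_mul] at h1 h2
    linarith

open PowerSeries in
theorem coeff_exp_sub_one (n : ℕ) : coeff n (exp ℝ - 1) = if n = 0 then 0 else 1 / (n ! : ℝ) := by
  rw [map_sub, coeff_exp, coeff_one]
  split_ifs with h <;> simp [h]

open PowerSeries in
theorem coeff_exp_sub_one_pow_nonneg (n p : ℕ) : 0 ≤ coeff n ((exp ℝ - 1) ^ p) := by
  have := surjCount_eq_coeff n p
  have h : 0 ≤ (n ! : ℝ) * coeff n ((exp ℝ - 1) ^ p) := this ▸ Nat.cast_nonneg _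
  exact nonneg_of_mul_nonneg_right h (by positivity)

open PowerSeries in
/-- Partial sums stay below the value of the series because all coefficients are nonnegative. -/
theorem sum_coeff_exp_sub_one_pow_le {x : ℝ} (hx : 0 ≤ x) (p N : ℕ) :
    ∑ n ∈ Finset.range N, coeff n ((exp ℝ - 1) ^ p) * x ^ n ≤ (Real.exp x - 1) ^ p := by
  induction p generalizing N with
  | zero =>
    simp only [pow_zero, coeff_one, ite_mul, one_mul, zero_mul, Finset.sum_ite_eq']
    split_ifs <;> simp
  | succ p ih =>
    have h1 : ∑ n ∈ Finset.range N, coeff n (exp ℝ - 1) * x ^ n ≤ Real.exp x - 1 := by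
      cases N with
      | zero => simpa using hx
      | succ N =>
        have := Real.sum_le_exp_of_nonneg hx (N + 1)
        rw [Finset.sum_range_succ'] at this ⊢
        simp only [coeff_exp_sub_one, Nat.add_eq_zero_iff, one_ne_zero, and_false, if_false,
          if_true, zero_mul, add_zero]
        simp only [pow_zero, Nat.factorial_zero, Nat.cast_one, div_one] at this
        calc _ = ∑ k ∈ Finset.range N, x ^ (k + 1) / (k + 1)! :=
              Finset.sum_congr rfl fun k _ => by ring
          _ ≤ _ := by linarith
    calc ∑ n ∈ Finset.range N, coeff n ((exp ℝ - 1) ^ (p + 1)) * x ^ n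
        = ∑ n ∈ Finset.range N, ∑ y ∈ Finset.HasAntidiagonal.antidiagonal n,
            (coeff y.1 ((exp ℝ - 1) ^ p) * x ^ y.1) * (coeff y.2 (exp ℝ - 1) * x ^ y.2) := by
          refine Finset.sum_congr rfl fun n _ => ?_
          rw [pow_succ, coeff_mul, Finset.sum_mul]
          refine Finset.sum_congr rfl fun y hy => ?_
          rw [← Finset.HasAntidiagonal.mem_antidiagonal.1 hy, pow_add]
          ring
      _ ≤ ∑ y ∈ Finset.range N ×ˢ Finset.range N,
            (coeff y.1 ((exp ℝ - 1) ^ p) * x ^ y.1) * (coeff y.2 (exp ℝ - 1) * x ^ y.2) := by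
          have hanti : ∀ n ∈ Finset.range N, Finset.HasAntidiagonal.antidiagonal n =
              ((Finset.range N ×ˢ Finset.range N).filter fun y => y.1 + y.2 < N).filter
                fun y => y.1 + y.2 = n := fun n hn => by
            ext y
            simp only [Finset.HasAntidiagonal.mem_antidiagonal, Finset.mem_filter,
              Finset.mem_product, Finset.mem_range] at hn ⊢
            omega
          rw [Finset.sum_congr rfl fun n hn => by rw [hanti n hn],
            Finset.sum_fiberwise_of_maps_to (fun y hy => by simpa using (Finset.mem_filter.1 hy).2)]
          refine Finset.sum_le_sum_of_subset_of_nonneg (Finset.filter_subset _ _) fun y _ _ => ?_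
          have h0 := coeff_exp_sub_one_pow_nonneg y.1 p
          have h1 := coeff_exp_sub_one_pow_nonneg y.2 1
          rw [pow_one] at h1
          positivity
      _ = (∑ n ∈ Finset.range N, coeff n ((exp ℝ - 1) ^ p) * x ^ n) *
            ∑ n ∈ Finset.range N, coeff n (exp ℝ - 1) * x ^ n := by
          rw [Finset.sum_mul_sum, Finset.sum_product]
      _ ≤ (Real.exp x - 1) ^ p * (Real.exp x - 1) := by
          refine mul_le_mul (ih N) h1 (Finset.sum_nonneg fun n _ => ?_) ?_
          · have := coeff_exp_sub_one_pow_nonneg n 1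
            rw [pow_one] at this
            positivity
          · have := Real.add_one_le_exp x
            exact pow_nonneg (by linarith) _
      _ = _ := (pow_succ _ _).symm

theorem surjCount_mul_pow_le {x : ℝ} (hx : 0 ≤ x) (k p : ℕ) :
    (surjCount k p : ℝ) * x ^ k ≤ k ! * (Real.exp x - 1) ^ p := by
  rw [surjCount_eq_coeff, mul_assoc]
  refine mul_le_mul_of_nonneg_left ?_ (by positivity)
  refine le_trans ?_ (sum_coeff_exp_sub_one_pow_le hx p (k + 1))
  exact Finset.single_le_sum (f := fun n => PowerSeries.coeff n ((PowerSeries.exp ℝ - 1) ^ p) * x ^ n)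
    (fun n _ => mul_nonneg (coeff_exp_sub_one_pow_nonneg n p) (by positivity))
    (Finset.self_mem_range_succ k)

/-- The number of ordered set partitions, divided by `m !`, is at least `(log 2)⁻ᵐ / 2`. The sequence
`a m` of these quotients satisfies `a m = ∑_{1 ≤ j ≤ m} a (m - j) / j !` for `0 < m`, and `(log 2)⁻ᵐ / 2` is a
subsolution because the Taylor remainder of `exp (log 2)` is at most twice its first term. -/
theorem half_mul_inv_log_two_pow_le (m : ℕ) {N : ℕ} (hN : m ≤ N) :
    1 / 2 * (Real.log 2)⁻¹ ^ m ≤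
      ∑ p ∈ Finset.range (N + 1), PowerSeries.coeff m ((PowerSeries.exp ℝ - 1) ^ p) := by
  induction m using Nat.strong_induction_on generalizing N with
  | _ m ih =>
    have hL := Real.log_pos one_lt_two
    rcases Nat.eq_zero_or_pos m with rfl | hm
    · rw [Finset.sum_range_succ']
      have : 0 ≤ ∑ k ∈ Finset.range N, PowerSeries.coeff 0 ((PowerSeries.exp ℝ - 1) ^ (k + 1)) :=
        Finset.sum_nonneg fun p _ => coeff_exp_sub_one_pow_nonneg 0 _
      simp only [pow_zero, PowerSeries.coeff_zero_one]
      linarith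
    obtain ⟨N, rfl⟩ : ∃ N', N = N' + 1 := ⟨N - 1, by omega⟩
    have hrec : ∑ p ∈ Finset.range (N + 1 + 1), PowerSeries.coeff m ((PowerSeries.exp ℝ - 1) ^ p) =
        ∑ j ∈ Finset.range (m + 1), PowerSeries.coeff j (PowerSeries.exp ℝ - 1) *
          ∑ p ∈ Finset.range (N + 1), PowerSeries.coeff (m - j) ((PowerSeries.exp ℝ - 1) ^ p) := by
      rw [Finset.sum_range_succ']
      simp only [pow_zero, PowerSeries.coeff_one, hm.ne', if_false, add_zero]
      simp only [pow_succ', PowerSeries.coeff_mul]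
      rw [Finset.sum_comm]
      simp only [← Finset.mul_sum]
      rw [Finset.Nat.sum_antidiagonal_eq_sum_range_succ_mk]
    have ha : ∀ j, 1 ≤ j → j ≤ m → 1 / 2 * (Real.log 2)⁻¹ ^ (m - j) ≤
        ∑ p ∈ Finset.range (N + 1), PowerSeries.coeff (m - j) ((PowerSeries.exp ℝ - 1) ^ p) :=
      fun j h1 h2 => ih _ (by omega) (by omega)
    have h0 : (1 : ℝ) ≤ ∑ p ∈ Finset.range (N + 1), PowerSeries.coeff 0 ((PowerSeries.exp ℝ - 1) ^ p) := by
      rw [Finset.sum_range_succ']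
      have : 0 ≤ ∑ k ∈ Finset.range N, PowerSeries.coeff 0 ((PowerSeries.exp ℝ - 1) ^ (k + 1)) :=
        Finset.sum_nonneg fun p _ => coeff_exp_sub_one_pow_nonneg 0 _
      simp only [pow_zero, PowerSeries.coeff_zero_one]
      linarith
    have hexp := Real.exp_bound' hL.le (by linarith [Real.log_two_lt_d9]) hm
    rw [Real.exp_log two_pos] at hexp
    have hrem : (Real.log 2) ^ m * ((m : ℝ) + 1) / (m ! * m) ≤ 2 * ((Real.log 2) ^ m / m !) := by
      have : (1 : ℝ) ≤ m := by exact_mod_cast hm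
      rw [← mul_div_assoc, div_le_div_iff₀ (by positivity) (by positivity)]
      have : 0 ≤ (Real.log 2) ^ m * m ! := by positivity
      nlinarith
    obtain ⟨M, rfl⟩ : ∃ M, m = M + 1 := ⟨m - 1, by omega⟩
    rw [hrec, Finset.sum_range_succ', Finset.sum_range_succ]
    rw [Finset.sum_range_succ'] at hexp
    have hc : ∀ j, PowerSeries.coeff (j + 1) (PowerSeries.exp ℝ - 1) = 1 / ((j + 1)! : ℝ) :=
      fun j => by simp [coeff_exp_sub_one]
    have hterm : ∀ j ∈ Finset.range M, 1 / 2 * (Real.log 2)⁻¹ ^ (M + 1) *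
        ((Real.log 2) ^ (j + 1) / (j + 1)!) ≤
        PowerSeries.coeff (j + 1) (PowerSeries.exp ℝ - 1) * ∑ p ∈ Finset.range (N + 1),
          PowerSeries.coeff (M + 1 - (j + 1)) ((PowerSeries.exp ℝ - 1) ^ p) := fun j hj => by
      have hj' := Finset.mem_range.1 hj
      have h1 := ha (j + 1) (by omega) (by omega)
      rw [hc]
      calc _ = 1 / ((j + 1)! : ℝ) * (1 / 2 * (Real.log 2)⁻¹ ^ (M + 1 - (j + 1))) := by
            rw [show M + 1 = (M + 1 - (j + 1)) + (j + 1) by omega, pow_add,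
              Nat.add_sub_cancel, inv_pow _ (j + 1)]
            field_simp
        _ ≤ _ := mul_le_mul_of_nonneg_left h1 (by positivity)
    have hlast : 1 / 2 * (Real.log 2)⁻¹ ^ (M + 1) * (2 * ((Real.log 2) ^ (M + 1) / (M + 1)!)) ≤
        PowerSeries.coeff (M + 1) (PowerSeries.exp ℝ - 1) * ∑ p ∈ Finset.range (N + 1),
          PowerSeries.coeff (M + 1 - (M + 1)) ((PowerSeries.exp ℝ - 1) ^ p) := by
      rw [hc, Nat.sub_self]
      calc _ = 1 / ((M + 1)! : ℝ) * 1 := by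
            rw [inv_pow]
            field_simp
        _ ≤ _ := mul_le_mul_of_nonneg_left h0 (by positivity)
    have hsum := Finset.sum_le_sum hterm
    rw [← Finset.mul_sum] at hsum
    have hzero : PowerSeries.coeff 0 (PowerSeries.exp ℝ - 1) = 0 := by simp [coeff_exp_sub_one]
    rw [hzero, zero_mul, add_zero]
    refine le_trans ?_ (add_le_add hsum hlast)
    rw [← mul_add]
    refine le_mul_of_one_le_right (by positivity) ?_
    simp only [pow_zero, Nat.factorial_zero, Nat.cast_one, div_one] at hexp
    linarith

/-! ### Bounds for the number of avoiding permutations -/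

theorem one_lt_two_mul_log_two : 1 < 2 * Real.log 2 := by linarith [Real.log_two_gt_d9]

/-- A crude Stirling bound that also holds for `k = 0`. -/
theorem factorial_le_exp_mul (k : ℕ) :
    (k ! : ℝ) ≤ Real.exp 1 * (k + 1) * (k / Real.exp 1) ^ k := by
  cases k with
  | zero => simp
  | succ k =>
    have h : Stirling.stirlingSeq (k + 1) ≤ Stirling.stirlingSeq 1 :=
      Stirling.stirlingSeq'_antitone (Nat.zero_le k)
    rw [Stirling.stirlingSeq_one, Stirling.stirlingSeq, div_le_iff₀ (by positivity)] at h
    refine h.trans ?_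
    rw [← mul_assoc]
    refine mul_le_mul_of_nonneg_right ?_ (by positivity)
    rw [Real.sqrt_mul zero_le_two, ← mul_assoc, div_mul_cancel₀ _ (by positivity)]
    refine mul_le_mul_of_nonneg_left (Real.sqrt_le_iff.2 ⟨by positivity, ?_⟩) (Real.exp_pos 1).le
    have : (0 : ℝ) ≤ (k + 1 : ℕ) := by positivity
    nlinarith

theorem pow_le_exp_pow_mul_factorial (n : ℕ) : (n : ℝ) ^ n ≤ Real.exp 1 ^ n * n ! := by
  have := Real.pow_div_factorial_le_exp (n : ℝ) (Nat.cast_nonneg n) n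
  rw [div_le_iff₀ (by positivity)] at this
  rwa [← Real.exp_nat_mul, mul_one]

theorem pow_mul_pow_le_three {A B : ℝ} (hA : 0 ≤ A) (hB : 0 ≤ B) (hA3 : A ≤ 3) (hB3 : B ≤ 3)
    (hAB : A * B ≤ 1) {p q : ℕ} (hpq : p ≤ q + 1) (hqp : q ≤ p + 1) : A ^ p * B ^ q ≤ 3 := by
  have h : ∀ r : ℕ, (A * B) ^ r ≤ 1 := fun r => pow_le_one₀ (mul_nonneg hA hB) hAB
  have h0 : ∀ r : ℕ, 0 ≤ (A * B) ^ r := fun r => pow_nonneg (mul_nonneg hA hB) r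
  obtain rfl | rfl | rfl : p = q ∨ p = q + 1 ∨ q = p + 1 := by omega
  · rw [← mul_pow]
    linarith [h p]
  · calc A ^ (q + 1) * B ^ q = (A * B) ^ q * A := by ring
      _ ≤ 1 * 3 := mul_le_mul (h q) hA3 hA zero_le_one
      _ = 3 := one_mul 3
  · calc A ^ p * B ^ (p + 1) = (A * B) ^ p * B := by ring
      _ ≤ 1 * 3 := mul_le_mul (h p) hB3 hB zero_le_one
      _ = 3 := one_mul 3

/-- The saddle points `x` and `y` for the two families of blocks are taken proportional to the
numbers of small and of large values, with `x + y = 2 * log 2`. Then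
`(exp x - 1) * (exp y - 1) ≤ 1` by the inequality between the arithmetic and the geometric mean, so
that the number of blocks does not matter. -/
theorem surjCount_mul_surjCount_mul_pow_le {k m p q : ℕ} (hn : 0 < k + m) (hpq : p ≤ q + 1)
    (hqp : q ≤ p + 1) : (surjCount k p * surjCount m q : ℝ) * (2 * Real.log 2) ^ (k + m) ≤
      27 * (k + m + 1) ^ 2 * (k + m)! := by
  set t := 2 * Real.log 2 with ht
  have ht0 : 0 < t := zero_lt_one.trans one_lt_two_mul_log_two
  have hexpt : Real.exp t = 4 := by
    rw [ht, two_mul, Real.exp_add, Real.exp_log two_pos]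
    norm_num
  have hN : (0 : ℝ) < k + m := by exact_mod_cast hn
  set x : ℝ := t * k / (k + m)
  set y : ℝ := t * m / (k + m)
  have hx : 0 ≤ x := by positivity
  have hy : 0 ≤ y := by positivity
  have hxy : x + y = t := by simp only [x, y]; field_simp
  have hprod : Real.exp x * Real.exp y = 4 := by rw [← Real.exp_add, hxy, hexpt]
  have hx1 := Real.one_le_exp hx
  have hy1 := Real.one_le_exp hy
  have h3 : (Real.exp x - 1) ^ p * (Real.exp y - 1) ^ q ≤ 3 := by
    refine pow_mul_pow_le_three (by linarith) (by linarith) (by nlinarith) (by nlinarith) ?_ hpq hqp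
    nlinarith [sq_nonneg (Real.exp x - Real.exp y)]
  have hk := factorial_le_exp_mul k
  have hm := factorial_le_exp_mul m
  have he : Real.exp 1 ^ 2 ≤ 9 := by
    have := Real.exp_one_lt_d9
    have := Real.exp_pos 1
    nlinarith
  have hfac : (k ! * m ! : ℝ) * (k + m) ^ (k + m) ≤
      9 * (k + m + 1) ^ 2 * (k + m)! * (k ^ k * m ^ m) := by
    have hpow := pow_le_exp_pow_mul_factorial (k + m)
    push_cast at hpow
    have hk1 : (k + 1 : ℝ) ≤ k + m + 1 := by linarith [(Nat.cast_nonneg m : (0 : ℝ) ≤ m)]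
    have hm1 : (m + 1 : ℝ) ≤ k + m + 1 := by linarith [(Nat.cast_nonneg k : (0 : ℝ) ≤ k)]
    calc (k ! * m ! : ℝ) * (k + m) ^ (k + m)
        ≤ ((Real.exp 1 * (k + 1) * (k / Real.exp 1) ^ k) *
            (Real.exp 1 * (m + 1) * (m / Real.exp 1) ^ m)) *
            (Real.exp 1 ^ (k + m) * (k + m)!) := by gcongr
      _ = Real.exp 1 ^ 2 * ((k + 1) * (m + 1)) * (k + m)! * (k ^ k * m ^ m) := by
          rw [div_pow, div_pow, pow_add]
          field_simp
      _ ≤ 9 * ((k + m + 1) * (k + m + 1)) * (k + m)! * (k ^ k * m ^ m) := by gcongr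
      _ = _ := by ring
  have hkk : (0 : ℝ) < (k : ℝ) ^ k * (m : ℝ) ^ m := by
    have : 0 < k ^ k * m ^ m := Nat.mul_pos Nat.pow_self_pos Nat.pow_self_pos
    exact_mod_cast this
  have hS := mul_le_mul (surjCount_mul_pow_le hx k p) (surjCount_mul_pow_le hy m q)
    (by positivity) (mul_nonneg (by positivity) (pow_nonneg (by linarith) _))
  refine le_of_mul_le_mul_right ?_ hkk
  calc (surjCount k p * surjCount m q : ℝ) * t ^ (k + m) * (k ^ k * m ^ m)
      = (surjCount k p * x ^ k) * (surjCount m q * y ^ m) * (k + m) ^ (k + m) := by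
        simp only [x, y, div_pow, mul_pow, pow_add]
        field_simp
    _ ≤ (k ! * (Real.exp x - 1) ^ p) * (m ! * (Real.exp y - 1) ^ q) * (k + m) ^ (k + m) := by
        gcongr
    _ = ((Real.exp x - 1) ^ p * (Real.exp y - 1) ^ q) * ((k ! * m !) * (k + m) ^ (k + m)) := by
        ring
    _ ≤ 3 * (9 * (k + m + 1) ^ 2 * (k + m)! * (k ^ k * m ^ m)) :=
        mul_le_mul h3 hfac (by positivity) (by norm_num)
    _ = _ := by ring

theorem avoidCount_mul_pow_le {n : ℕ} (hn : 0 < n) :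
    (avoidCount n {pattern21d34, pattern34d21} : ℝ) * (2 * Real.log 2) ^ n ≤
      54 * ((n : ℝ) + 1) ^ 5 * n ! := by
  have hL := Real.log_pos one_lt_two
  have h : (avoidCount n {pattern21d34, pattern34d21} : ℝ) ≤ _ :=
    Nat.cast_le.2 (avoidCount_le_sum hn)
  push_cast at h
  refine (mul_le_mul_of_nonneg_right h (by positivity)).trans ?_
  rw [Finset.sum_mul]
  have hterm : ∀ k ∈ Finset.range (n + 1), (∑ _s ∈ ({0, 2} : Finset ℕ),
      ∑ y ∈ (Finset.range (n + 1) ×ˢ Finset.range (n + 1)).filter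
        fun y => y.1 ≤ y.2 + 1 ∧ y.2 ≤ y.1 + 1,
          (surjCount k y.1 * surjCount (n - k) y.2 : ℝ)) * (2 * Real.log 2) ^ n ≤
      54 * (n + 1) ^ 4 * n ! := by
    intro k hk
    obtain ⟨m, rfl⟩ := Nat.exists_eq_add_of_le (Finset.mem_range_succ_iff.1 hk)
    rw [Nat.add_sub_cancel_left, Finset.sum_const, Finset.card_pair (by norm_num), nsmul_eq_mul,
      mul_assoc, Finset.sum_mul]
    have hcard : ((((Finset.range (k + m + 1) ×ˢ Finset.range (k + m + 1)).filter
        fun y => y.1 ≤ y.2 + 1 ∧ y.2 ≤ y.1 + 1).card : ℕ) : ℝ) ≤ (k + m + 1) ^ 2 := by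
      have := Finset.card_filter_le (Finset.range (k + m + 1) ×ˢ Finset.range (k + m + 1))
        fun y => y.1 ≤ y.2 + 1 ∧ y.2 ≤ y.1 + 1
      rw [Finset.card_product, Finset.card_range, ← sq] at this
      exact_mod_cast this
    have hsum := Finset.sum_le_card_nsmul
      ((Finset.range (k + m + 1) ×ˢ Finset.range (k + m + 1)).filter
        fun y => y.1 ≤ y.2 + 1 ∧ y.2 ≤ y.1 + 1)
      (fun y => (surjCount k y.1 * surjCount m y.2 : ℝ) * (2 * Real.log 2) ^ (k + m)) _
      fun y hy => surjCount_mul_surjCount_mul_pow_le hn (Finset.mem_filter.1 hy).2.1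
        (Finset.mem_filter.1 hy).2.2
    rw [nsmul_eq_mul] at hsum
    have := hsum.trans (mul_le_mul_of_nonneg_right hcard (by positivity))
    push_cast
    nlinarith
  refine (Finset.sum_le_card_nsmul _ _ _ hterm).trans (le_of_eq ?_)
  rw [Finset.card_range, nsmul_eq_mul]
  push_cast
  ring

theorem surjCount_le_succ {m : ℕ} (hm : 0 < m) (p : ℕ) : surjCount m p ≤ surjCount (m + 1) p := by
  refine Nat.card_le_card_of_injective (fun f => ⟨Fin.snoc f.1 (f.1 ⟨0, hm⟩), fun x => ?_⟩) ?_
  · obtain ⟨i, hi⟩ := f.2 x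
    exact ⟨i.castSucc, by simpa using hi⟩
  · intro f g h
    have h := congrArg Subtype.val h
    refine Subtype.ext (funext fun i => ?_)
    simpa using congrFun h i.castSucc

/-- Some block count is attained by at least the average number of surjections. -/
theorem exists_le_surjCount (m : ℕ) :
    ∃ p, (m ! : ℝ) * (Real.log 2)⁻¹ ^ m ≤ 2 * (m + 1) * surjCount m p := by
  have hsum : ∑ _p ∈ Finset.range (m + 1), 1 / 2 * (Real.log 2)⁻¹ ^ m / (m + 1 : ℝ) ≤
      ∑ p ∈ Finset.range (m + 1), PowerSeries.coeff m ((PowerSeries.exp ℝ - 1) ^ p) := by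
    refine le_trans (le_of_eq ?_) (half_mul_inv_log_two_pow_le m le_rfl)
    rw [Finset.sum_const, Finset.card_range, nsmul_eq_mul]
    push_cast
    field_simp
  obtain ⟨p, -, hp⟩ := Finset.exists_le_of_sum_le (by simp) hsum
  refine ⟨p, ?_⟩
  rw [div_le_iff₀ (by positivity)] at hp
  rw [surjCount_eq_coeff]
  have : (0 : ℝ) < m ! := by positivity
  nlinarith

/-- The lower bound comes from permutations with equally many small and large blocks, where the common
number of blocks is a most popular one. -/
theorem factorial_le_avoidCount_mul_pow {n : ℕ} (hn : 2 ≤ n) :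
    (n ! : ℝ) ≤ 4 * ((n : ℝ) + 1) ^ 3 *
      (avoidCount n {pattern21d34, pattern34d21} * (2 * Real.log 2) ^ n) := by
  have hL := Real.log_pos one_lt_two
  -- Half of the values are small. For odd `n` the loss of a factor `n` is harmless.
  obtain ⟨m, j, hj, rfl⟩ : ∃ m j, j ≤ 1 ∧ n = m + (m + j) := ⟨n / 2, n % 2, by omega, by omega⟩
  have hm : 0 < m := by omega
  obtain ⟨p, hp⟩ := exists_le_surjCount m
  have hcount : surjCount m p * surjCount m p ≤
      avoidCount (m + (m + j)) {pattern21d34, pattern34d21} := by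
    refine le_trans (Nat.mul_le_mul_left _ ?_) (surjCount_mul_surjCount_le m (m + j) p)
    interval_cases j
    exacts [le_rfl, surjCount_le_succ hm p]
  have hcount' : (surjCount m p * surjCount m p : ℝ) ≤
      avoidCount (m + (m + j)) {pattern21d34, pattern34d21} := by exact_mod_cast hcount
  have hfac : (m + (m + j))! ≤ 4 ^ m * (m ! * m !) * (2 * m + 1) := by
    have h1 : (m + m)! ≤ 4 ^ m * (m ! * m !) := by
      rw [← Nat.add_choose_mul_factorial_mul_factorial, mul_assoc]
      refine Nat.mul_le_mul_right _ ?_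
      rw [← two_mul, ← Nat.centralBinom_eq_two_mul_choose]
      exact Nat.centralBinom_le_four_pow m
    interval_cases j
    · exact h1.trans (Nat.le_mul_of_pos_right _ (by omega))
    · rw [show m + (m + 1) = (m + m) + 1 by omega, Nat.factorial_succ, mul_comm]
      exact Nat.mul_le_mul h1 (by omega)
  have hfac' : ((m + (m + j))! : ℝ) ≤ 4 ^ m * (m ! * m !) * (2 * m + 1) := by exact_mod_cast hfac
  have hpow : (4 : ℝ) ^ m * Real.log 2 ^ (2 * m) ≤ (2 * Real.log 2) ^ (m + (m + j)) := by
    calc (4 : ℝ) ^ m * Real.log 2 ^ (2 * m) = (2 * Real.log 2) ^ (2 * m) := by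
          rw [mul_pow, pow_mul 2 2 m]; norm_num
      _ ≤ _ := pow_le_pow_right₀ one_lt_two_mul_log_two.le (by omega)
  have hsq : (m ! * m ! : ℝ) ≤ 4 * (m + 1) ^ 2 * (surjCount m p * surjCount m p) *
      Real.log 2 ^ (2 * m) := by
    have := mul_le_mul hp hp (by positivity) (by positivity)
    calc (m ! * m ! : ℝ) = (m ! * (Real.log 2)⁻¹ ^ m * (m ! * (Real.log 2)⁻¹ ^ m)) *
          Real.log 2 ^ (2 * m) := by
          rw [two_mul, pow_add, inv_pow]
          field_simp
      _ ≤ (2 * (m + 1) * surjCount m p * (2 * (m + 1) * surjCount m p)) * Real.log 2 ^ (2 * m) :=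
          mul_le_mul_of_nonneg_right this (by positivity)
      _ = _ := by ring
  have hpoly : ((m : ℝ) + 1) ^ 2 * (2 * m + 1) ≤ (((m + (m + j) : ℕ) : ℝ) + 1) ^ 3 := by
    push_cast
    have h1 : (0 : ℝ) ≤ m := by positivity
    have h2 : (0 : ℝ) ≤ j := by positivity
    calc ((m : ℝ) + 1) ^ 2 * (2 * m + 1) ≤ (m + (m + j) + 1) ^ 2 * (m + (m + j) + 1) := by
          gcongr <;> linarith
      _ = _ := by ring
  calc ((m + (m + j))! : ℝ) ≤ 4 ^ m * (m ! * m !) * (2 * m + 1) := hfac'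
    _ ≤ 4 ^ m * (4 * (m + 1) ^ 2 * (surjCount m p * surjCount m p) * Real.log 2 ^ (2 * m)) *
        (2 * m + 1) := by gcongr
    _ = 4 * ((m + 1) ^ 2 * (2 * m + 1)) *
        ((surjCount m p * surjCount m p) * (4 ^ m * Real.log 2 ^ (2 * m))) := by ring
    _ ≤ _ := by gcongr

/-! ### The limit -/

theorem tendsto_poly_rpow_one_div (C : ℝ) (hC : 0 < C) (d : ℕ) :
    Tendsto (fun n : ℕ => (C * ((n : ℝ) + 1) ^ d) ^ (1 / (n : ℝ))) atTop (𝓝 1) := by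
  have h1 : Tendsto (fun n : ℕ => C ^ (1 / (n : ℝ))) atTop (𝓝 1) := by
    have := (Real.continuous_const_rpow hC.ne').tendsto 0 |>.comp
      (tendsto_one_div_atTop_nhds_zero_nat (𝕜 := ℝ))
    simpa [Function.comp_def] using this
  have h2 : Tendsto (fun n : ℕ => ((n : ℝ) + 1) ^ ((d : ℝ) / (1 * ((n : ℝ) + 1) + -1))) atTop (𝓝 1) :=
    (tendsto_rpow_div_mul_add d 1 (-1) zero_ne_one).comp
      (tendsto_atTop_add_const_right _ 1 tendsto_natCast_atTop_atTop)
  have h := h1.mul h2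
  rw [one_mul] at h
  refine h.congr fun n => ?_
  rw [Real.mul_rpow hC.le (by positivity), ← Real.rpow_natCast, ← Real.rpow_mul (by positivity)]
  congr 2
  ring

theorem tendsto_avoidCount_div_factorial_rpow :
    Tendsto (fun n : ℕ =>
        ((avoidCount n {pattern21d34, pattern34d21} : ℝ) / (n ! : ℝ)) ^ (1 / (n : ℝ)))
      atTop (𝓝 (1 / (2 * Real.log 2))) := by
  have ht0 : 0 < 2 * Real.log 2 := zero_lt_one.trans one_lt_two_mul_log_two
  set a : ℕ → ℝ := fun n => (avoidCount n {pattern21d34, pattern34d21} : ℝ) / (n ! : ℝ) with ha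
  have ha0 : ∀ n, 0 ≤ a n := fun n => by positivity
  have h : Tendsto (fun n : ℕ => (a n * (2 * Real.log 2) ^ n) ^ (1 / (n : ℝ))) atTop (𝓝 1) := by
    have hlow := (tendsto_poly_rpow_one_div 4 (by norm_num) 3).inv₀ one_ne_zero
    rw [inv_one] at hlow
    refine tendsto_of_tendsto_of_tendsto_of_le_of_le' hlow
      (tendsto_poly_rpow_one_div 54 (by norm_num) 5) ?_ ?_
    · filter_upwards [eventually_ge_atTop 2] with n hn
      rw [← Real.inv_rpow (by positivity)]
      refine Real.rpow_le_rpow (by positivity) ?_ (by positivity)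
      have := factorial_le_avoidCount_mul_pow hn
      rw [inv_le_iff_one_le_mul₀' (by positivity), ha]
      calc (1 : ℝ) = n ! / n ! := (div_self (by positivity)).symm
        _ ≤ _ := div_le_div_of_nonneg_right this (by positivity)
        _ = _ := by ring
    · filter_upwards [eventually_gt_atTop 0] with n hn
      refine Real.rpow_le_rpow (mul_nonneg (ha0 n) (by positivity)) ?_ (by positivity)
      have := avoidCount_mul_pow_le hn
      rw [ha]
      dsimp only
      rw [div_mul_eq_mul_div, div_le_iff₀ (by positivity)]
      exact this
  refine (h.div_const (2 * Real.log 2)).congr' ?_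
  filter_upwards [eventually_gt_atTop 0] with n hn
  rw [Real.mul_rpow (ha0 n) (by positivity), one_div, Real.pow_rpow_inv_natCast ht0.le hn.ne',
    mul_div_assoc, div_self ht0.ne', mul_one]

theorem avoidCount_anti {n : ℕ} {P Q : Set GeneralizedPattern} (h : P ⊆ Q) :
    avoidCount n Q ≤ avoidCount n P :=
  Nat.card_le_card_of_injective (fun π => ⟨π.1, fun p hp => π.2 p (h hp)⟩)
    fun _ _ e => Subtype.ext (Subtype.mk.inj e)

theorem avoidCount_zero (P : Set GeneralizedPattern) : avoidCount 0 P = 1 := by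
  have : Unique {π : Equiv.Perm (Fin 0) // ∀ p ∈ P, ¬ p.Occurs π} :=
    { default := ⟨1, fun _ _ ⟨ℓ, _⟩ => (ℓ 0).elim0⟩
      uniq := fun _ => Subtype.ext (Subsingleton.elim _ _) }
  exact Nat.card_unique

theorem corollary1p3 :
    Tendsto (fun n : ℕ =>
        ((avoidCount n {pattern21d34, pattern34d21} : ℝ) / (n ! : ℝ)) ^ (1 / (n : ℝ)))
      atTop (𝓝 (1 / (2 * Real.log 2))) ∧
    (0.7213 < 1 / (2 * Real.log 2) ∧ 1 / (2 * Real.log 2) < 0.7214) ∧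
    ∃ ε : ℕ → ℝ, Tendsto ε atTop (𝓝 0) ∧
      ∀ n : ℕ,
        avoidCount n {pattern21d34} ≥ avoidCount n {pattern21d34, pattern34d21} ∧
        (avoidCount n {pattern21d34, pattern34d21} : ℝ)
          = (1 / (2 * Real.log 2) + ε n) ^ n * (n ! : ℝ) := by
  have h1 := Real.log_two_gt_d9
  have h2 := Real.log_two_lt_d9
  refine ⟨tendsto_avoidCount_div_factorial_rpow, ⟨?_, ?_⟩,
    fun n => ((avoidCount n {pattern21d34, pattern34d21} : ℝ) / (n ! : ℝ)) ^ (1 / (n : ℝ)) -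
      1 / (2 * Real.log 2), ?_, fun n => ⟨avoidCount_anti (by simp), ?_⟩⟩
  · rw [lt_div_iff₀ (by linarith)]
    linarith
  · rw [div_lt_iff₀ (by linarith)]
    linarith
  · simpa using tendsto_avoidCount_div_factorial_rpow.sub_const (1 / (2 * Real.log 2))
  · rw [add_sub_cancel]
    rcases Nat.eq_zero_or_pos n with rfl | hn
    · simp [avoidCount_zero]
    · rw [one_div, Real.rpow_inv_natCast_pow (by positivity) hn.ne',
        div_mul_cancel₀ _ (by positivity)]
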